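/- Let $n\ge 0$, $\mu\in\mathbb R^n$, let $\Sigma$ be a diagonal positive semidefinite real $n\times n$ matrix, let $X\sim\mathcal N(\mu,\Sigma)$ be a Gaussian random vector, and let $K=(K_1,\dots,K_n)$ be uniformly distributed on $(\{0,1\}^3)^n$ ($3n$ key bits) and independent of $X$. For a random variable $Z$ (a transmitted packet) let $D(z)=\min_{a\in\mathbb R^n}\mathbb E\big[\|X-a\|^2\,\big|\,Z=z\big]=\operatorname{tr}(R_{X\mid Z=z})$, where $R_{X\mid Z=z}$ is the conditional covariance matrix, be the distortion of an eavesdropper who observes $Z=z$ but not the key, and let $D_W(Z)=\operatorname{ess\,inf}_z D(z)$, under the law of $Z$, be the worst-case distortion. Put $\theta=4.84$. Identify $\kappa\in\{0,1\}^3$ with the integer in $\{0,\dots,7\}$ that it represents in binary, and for $v\in\mathbb R$ let $$\mathcal E(v,\kappa)=\begin{cases} v+\kappa\,\tfrac{2\theta}{8}\ \bmod\ [-\theta,\theta), & v\in[-\theta,\theta),\\ v, & |v|>\theta,\ \kappa<4,\\ -v, & |v|>\theta,\ \kappa\ge 4,\end{cases}$$ where $r \bmod [a,b)$ is the element of $[a,b)$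 that differs from $r$ by an integer multiple of $b-a$ (and $\mathcal E(\theta,\kappa)=\theta$). Transmit $Z=(Z^{(1)},\dots,Z^{(n)})$ with $Z^{(i)}=\mathcal E\big((X^{(i)}-\mu^{(i)})/\sqrt{\Sigma_{ii}},\,K_i\big)$, where the quotient is read as $0$ if $\Sigma_{ii}=0$. Then: 1. the receiver who knows the key recovers $X$ without loss: the decoder that inverts $\mathcal E(\cdot,K_i)$ in each coordinate and undoes the normalization returns $X$ from $(Z,K)$ almost surely; 2. $D_W(Z)\ \ge\ 0.9998\cdot\operatorname{tr}(\Sigma)$; 3. $\operatorname{tr}(\Sigma)$ is optimal: $D_W(Z')\le\operatorname{tr}(\Sigma)$ for every random variable $Z'$, with values in any measurable space, defined on the same probability space as $X$, and an eavesdropper with no observation (constant $Z'$) has distortion exactly $\operatorname{tr}(\Sigma)$. -/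

import Mathlib

open MeasureTheory ProbabilityTheory
open scoped ENNReal

namespace DistortionSecurity

noncomputable section

/-- The unique representative of `r` modulo `b - a` in `[a, b)` (for `a < b`):
`r - i (b - a)` with `i` an integer. -/
def modIco (a b r : ℝ) : ℝ := r - (⌊(r - a) / (b - a)⌋ : ℝ) * (b - a)

/-- The number in `{0, …, 2 ^ k - 1}` with binary expansion `κ`, most significant bit first. -/
def keyValue {k : ℕ} (κ : Fin k → Bool) : ℕ :=
  ∑ j : Fin k, if κ j then 2 ^ (Fin.rev j : ℕ) else 0

open Classical in
/-- The scalar shifting+mirroring encoder with a `k`-bit key `κ` and window `[-θ, θ)`. Points of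
the window are shifted cyclically by `κ` steps of length `2 θ / 2 ^ k`; points with `|x| > θ` are
kept for half of the keys and reflected for the other half. The single remaining point `x = θ` is
sent as it is. -/
def scalarEnc {k : ℕ} (θ : ℝ) (x : ℝ) (κ : Fin k → Bool) : ℝ :=
  if x ∈ Set.Ico (-θ) θ then modIco (-θ) θ (x + keyValue κ * (2 * θ / 2 ^ k))
  else if θ < |x| ∧ 2 ^ (k - 1) ≤ keyValue κ then -x
  else x

open Classical in
/-- The scalar decoder of the legitimate receiver, who knows the key `κ`: undo the shift, or the
reflection. -/
def scalarDec {k : ℕ} (θ : ℝ) (z : ℝ) (κ : Fin k → Bool) : ℝ :=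
  if z ∈ Set.Ico (-θ) θ then modIco (-θ) θ (z - keyValue κ * (2 * θ / 2 ^ k))
  else if θ < |z| ∧ 2 ^ (k - 1) ≤ keyValue κ then -z
  else z

/-- The coordinatewise scheme for a vector with (public) mean `μ` and diagonal covariance `S`:
the `i`-th coordinate is normalised to `(x i - μ i) / √(S i i)` (which is `0` if `S i i = 0`), and
encoded by the scalar scheme with its own `k`-bit key `κ i`. -/
def vectorEnc {n k : ℕ} (θ : ℝ) (μ : EuclideanSpace ℝ (Fin n)) (S : Matrix (Fin n) (Fin n) ℝ)
    (x : EuclideanSpace ℝ (Fin n)) (κ : Fin n → Fin k → Bool) : EuclideanSpace ℝ (Fin n) :=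
  WithLp.toLp 2 fun i => scalarEnc θ ((x i - μ i) / √(S i i)) (κ i)

/-- The decoder of the legitimate receiver for the coordinatewise scheme. -/
def vectorDec {n k : ℕ} (θ : ℝ) (μ : EuclideanSpace ℝ (Fin n)) (S : Matrix (Fin n) (Fin n) ℝ)
    (z : EuclideanSpace ℝ (Fin n)) (κ : Fin n → Fin k → Bool) : EuclideanSpace ℝ (Fin n) :=
  WithLp.toLp 2 fun i => μ i + √(S i i) * scalarDec θ (z i) (κ i)

/-- The distortion `D(z) = min_a 𝔼[‖X - a‖² | Z = z]` of an eavesdropper who has received the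
packet `z`, makes the best estimate `a` of `X`, and does not know the key. The expectation is with
respect to the regular conditional distribution of `X` given `Z = z`. The minimum is attained at
the conditional mean, so that `D(z)` is the trace of the conditional covariance matrix of `X`
given `Z = z`. -/
def distortion {Ω : Type*} [MeasurableSpace Ω] (P : Measure Ω) [IsFiniteMeasure P] {n : ℕ}
    {𝒵 : Type*} [MeasurableSpace 𝒵] (X : Ω → EuclideanSpace ℝ (Fin n)) (Z : Ω → 𝒵)
    (z : 𝒵) : ℝ≥0∞ :=
  ⨅ a : EuclideanSpace ℝ (Fin n), ∫⁻ x, ‖x - a‖ₑ ^ 2 ∂(condDistrib X Z P z)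

/-- The worst case distortion `D_W = min_z D(z)`. Since conditional distributions given `Z = z` are
only determined for almost every `z`, the minimum is the essential one, under the law of `Z`. -/
def worstCaseDistortion {Ω : Type*} [MeasurableSpace Ω] (P : Measure Ω) [IsFiniteMeasure P] {n : ℕ}
    {𝒵 : Type*} [MeasurableSpace 𝒵] (X : Ω → EuclideanSpace ℝ (Fin n)) (Z : Ω → 𝒵) : ℝ≥0∞ :=
  essInf (distortion P X Z) (P.map Z)

end

end DistortionSecurity

/-! For each fixed key the scalar encoder is a bijection of `ℝ` preserving Lebesgue measure. A
scalar packet `z` therefore has eight possible sources, one per key, weighted by the Gaussian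
density at each. For `|z| > 4.84` they are `z` and `-z`, four times each, with variance `z ^ 2`. For
`z` in the window they form a lattice of mesh `1.21` filling the window, and the claim becomes an
explicit inequality for the variance of eight Gaussian weights (`gaussian_lattice_second_moment`).

Conditional laws are never computed. `le_worstCaseDistortion` reduces a lower bound on `D_W` to the
inequality between `c` and `‖X - a‖²` integrated against indicators of packet events, for each fixed
`a`. Allowing arbitrary measurable weights `w` of the packet lets the scalar bound pass to vectors:
with all coordinates and keys but the `i`-th frozen, `w` is a weight of the `i`-th packet coordinate
alone (`lintegral_coordinate_second_moment`).

The upper bound holds since an essential infimum is at most the mean, and the constant estimate `μ`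
has mean squared error `tr S`. -/

namespace DistortionSecurity

/-! ### Variance of Gaussian weights on eight lattice points -/

/-- The variance of the weights `Q ^ 6, Q ^ 3 u, Q u ^ 2, u ^ 3, u ^ 4, Q u ^ 5, Q ^ 3 u ^ 6,
Q ^ 6 u ^ 7` on `0, …, 7`, in homogeneous form. The difference of the two sides is `u ^ 7` times a
polynomial of degree 7 in `u + u⁻¹`, whose Bernstein coefficients on `[2, 2.6]` are nonnegative. -/
lemma variance_certificate_nonneg {Q u : ℝ} (hQ₀ : 0.231286 ≤ Q) (hQ₁ : Q ≤ 0.2312862)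
    (hu₀ : 0.47 ≤ u) (hu₁ : u ≤ 2.13) :
    0.9998 * (Q ^ 6 + Q ^ 3 * u + Q * u ^ 2 + u ^ 3 + u ^ 4 + Q * u ^ 5 + Q ^ 3 * u ^ 6
        + Q ^ 6 * u ^ 7) ^ 2 ≤
      1.4641 * ((Q ^ 6 + Q ^ 3 * u + Q * u ^ 2 + u ^ 3 + u ^ 4 + Q * u ^ 5 + Q ^ 3 * u ^ 6
        + Q ^ 6 * u ^ 7) * (Q ^ 3 * u + 4 * (Q * u ^ 2) + 9 * u ^ 3 + 16 * u ^ 4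
          + 25 * (Q * u ^ 5) + 36 * (Q ^ 3 * u ^ 6) + 49 * (Q ^ 6 * u ^ 7)) -
        (Q ^ 3 * u + 2 * (Q * u ^ 2) + 3 * u ^ 3 + 4 * u ^ 4 + 5 * (Q * u ^ 5)
          + 6 * (Q ^ 3 * u ^ 6) + 7 * (Q ^ 6 * u ^ 7)) ^ 2) := by
  have hQ : (0 : ℝ) ≤ 0.231286 := by norm_num
  have hQ' : 0 ≤ Q := hQ.trans hQ₀
  have h2 := pow_le_pow_left₀ hQ hQ₀ 2
  have h3 := pow_le_pow_left₀ hQ hQ₀ 3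
  have h4 := pow_le_pow_left₀ hQ hQ₀ 4
  have h6 := pow_le_pow_left₀ hQ hQ₀ 6
  have h7 := pow_le_pow_left₀ hQ hQ₀ 7
  have h9 := pow_le_pow_left₀ hQ hQ₀ 9
  have h12 := pow_le_pow_left₀ hQ hQ₀ 12
  have k12 := pow_le_pow_left₀ hQ' hQ₁ 12
  norm_num at h2 h3 h4 h6 h7 h9 h12 k12
  -- `b0, …, b7` are the Bernstein coefficients, binomial factors included, as polynomials in `Q`.
  -- Each is linear in the powers of `Q` bounded above; the upper bound `k12` serves the negative `Q
  -- ^ 12` terms of `b5`, `b6`, `b7`.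
  obtain ⟨b0, e0⟩ : ∃ b, b =
      (-25351/10000) + (33213/5000) * Q + (91777/10000) * Q ^ 2 + (150341/5000) * Q ^ 3
      + (41781/1000) * Q ^ 4 + (978099/10000) * Q ^ 6 + (384597/5000) * Q ^ 7
      + (20069/200) * Q ^ 9 + (677417/10000) * Q ^ 12 := ⟨_, rfl⟩
  have hb0 : 0 ≤ b0 := by rw [e0]; linarith
  obtain ⟨b1, e1⟩ : ∃ b, b =
      (-917279/50000) + (1188177/25000) * Q + (2942249/50000) * Q ^ 2 + (6453241/25000) * Q ^ 3
      + (1500909/5000) * Q ^ 4 + (44633739/50000) * Q ^ 6 + (16983369/25000) * Q ^ 7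
      + (721273/1000) * Q ^ 9 + (22239889/50000) * Q ^ 12 := ⟨_, rfl⟩
  have hb1 : 0 ≤ b1 := by rw [e1]; linarith
  obtain ⟨b2, e2⟩ : ∃ b, b =
      (-2841819/50000) + (1454751/10000) * Q + (39544653/250000) * Q ^ 2
      + (232425039/250000) * Q ^ 3 + (4599171/5000) * Q ^ 4 + (34108011/10000) * Q ^ 6
      + (635645151/250000) * Q ^ 7 + (22001511/10000) * Q ^ 9 + (293916273/250000) * Q ^ 12 := ⟨_, rfl⟩
  have hb2 : 0 ≤ b2 := by rw [e2]; linarith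
  obtain ⟨b3, e3⟩ : ∃ b, b =
      (-977267/10000) + (2469603/10000) * Q + (286527379/1250000) * Q ^ 2
      + (2287220311/1250000) * Q ^ 3 + (194731707/125000) * Q ^ 4 + (8879517753/1250000) * Q ^ 6
      + (1311054507/250000) * Q ^ 7 + (920195171/250000) * Q ^ 9 + (1892283701/1250000) * Q ^ 12 := ⟨_, rfl⟩
  have hb3 : 0 ≤ b3 := by rw [e3]; linarith
  obtain ⟨b4, e4⟩ : ∃ b, b =
      (-1007261/10000) + (156963/625) * Q + (238476991/1250000) * Q ^ 2
      + (166586659/78125) * Q ^ 3 + (1967880279/1250000) * Q ^ 4 + (27302336709/3125000) * Q ^ 6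
      + (503951616/78125) * Q ^ 7 + (2269530683/625000) * Q ^ 9 + (995553083/1250000) * Q ^ 12 := ⟨_, rfl⟩
  have hb4 : 0 ≤ b4 := by rw [e4]; linarith
  obtain ⟨b5, e5⟩ : ∃ b, b =
      (-622353/10000) + (153) * Q + (111070599/1250000) * Q ^ 2 + (115215576/78125) * Q ^ 3
      + (1186008417/1250000) * Q ^ 4 + (99380898153/15625000) * Q ^ 6
      + (18507132153/3906250) * Q ^ 7 + (6556951527/3125000) * Q ^ 9
      + (-6011274003/31250000) * Q ^ 12 := ⟨_, rfl⟩
  have hb5 : 0 ≤ b5 := by rw [e5]; linarith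
  obtain ⟨b6, e6⟩ : ∃ b, b =
      (-1067249/50000) + (2585379/50000) * Q + (25235891/1250000) * Q ^ 2
      + (701869619/1250000) * Q ^ 3 + (394460277/1250000) * Q ^ 4 + (9931025049/3906250) * Q ^ 6
      + (60170358123/31250000) * Q ^ 7 + (10160421103/15625000) * Q ^ 9
      + (-62988253993/156250000) * Q ^ 12 := ⟨_, rfl⟩
  have hb6 : 0 ≤ b6 := by rw [e6]; linarith
  obtain ⟨b7, e7⟩ : ∃ b, b =
      (-156749/50000) + (74787/10000) * Q + (1754069/1250000) * Q ^ 2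
      + (113635031/1250000) * Q ^ 3 + (55806819/1250000) * Q ^ 4 + (6734917113/15625000) * Q ^ 6
      + (10442297799/31250000) * Q ^ 7 + (1277093293/15625000) * Q ^ 9
      + (-101224631141/781250000) * Q ^ 12 := ⟨_, rfl⟩
  have hb7 : 0 ≤ b7 := by rw [e7]; linarith
  -- With `s = (u + u⁻¹ - 2) / 0.6`, the Bernstein variable on `[2, 2.6]`, one has `α = u * s` and
  -- `β = u * (1 - s)`. The range `[0.47, 2.13]` of `u` ensures `u + u⁻¹ ≤ 2.6`, hence `0 ≤ β`.
  obtain ⟨α, hα⟩ : ∃ α, α = 5 / 3 * (u - 1) ^ 2 := ⟨_, rfl⟩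
  have hα₀ : 0 ≤ α := by rw [hα]; positivity
  obtain ⟨β, hβ⟩ : ∃ β, β = u - α := ⟨_, rfl⟩
  have hβ₀ : 0 ≤ β := by rw [hβ, hα]; nlinarith
  have key : 0 ≤ b0 * β ^ 7 + b1 * (α * β ^ 6) + b2 * (α ^ 2 * β ^ 5) + b3 * (α ^ 3 * β ^ 4)
      + b4 * (α ^ 4 * β ^ 3) + b5 * (α ^ 5 * β ^ 2) + b6 * (α ^ 6 * β) + b7 * α ^ 7 := by
    positivity
  refine sub_nonneg.1 (key.trans_eq ?_)
  subst e0 e1 e2 e3 e4 e5 e6 e7 hβ hα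
  ring

lemma exp_neg_bounds : 0.231286 ≤ Real.exp (-1.4641) ∧ Real.exp (-1.4641) ≤ 0.2312862 := by
  -- `0.366025 = 1.4641 / 4`: the Taylor bound is applied at a quarter of the exponent, and the
  -- result raised to the fourth power.
  have h := Real.exp_bound (x := -0.366025) (by norm_num [abs_le]) (n := 10) (by norm_num)
  rw [abs_le] at h
  norm_num [Finset.sum_range_succ, Nat.factorial] at h
  have e : Real.exp (-1.4641) = Real.exp (-(14641 / 40000)) ^ 4 := by
    rw [← Real.exp_nat_mul]; norm_num
  rw [e]
  have h1 : 0.69348545 ≤ Real.exp (-(14641 / 40000)) := by linarith [h.1]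
  have h2 : Real.exp (-(14641 / 40000)) ≤ 0.69348547 := by linarith [h.2]
  constructor
  · refine le_trans (by norm_num) (pow_le_pow_left₀ (by norm_num) h1 4)
  · exact (pow_le_pow_left₀ (by positivity) h2 4).trans (by norm_num)

/-- Multiplied by `S₀`, the quadratic in `b` is `(S₁ - b * S₀) ^ 2` plus the slack in `h`. This
turns a variance bound into a bound for the second moment about every point. -/
lemma quadratic_nonneg_of_moments {c S₀ S₁ S₂ : ℝ} (h₀ : 0 < S₀)
    (h : c * S₀ ^ 2 ≤ S₀ * S₂ - S₁ ^ 2) (b : ℝ) : 0 ≤ S₂ - 2 * b * S₁ + b ^ 2 * S₀ - c * S₀ := by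
  have : 0 ≤ S₀ * (S₂ - 2 * b * S₁ + b ^ 2 * S₀ - c * S₀) := by nlinarith [sq_nonneg (S₁ - b * S₀)]
  exact nonneg_of_mul_nonneg_right this h₀

/-- The second moment, about any point, of the Gaussian weights on the eight points
`t - 4.84 + 1.21 j` is at least `0.9998`. -/
lemma gaussian_lattice_second_moment {t : ℝ} (ht₀ : 0 ≤ t) (ht₁ : t ≤ 1.21) (b : ℝ) :
    ∑ j : Fin 8, Real.exp (-(t - 4.84 + 1.21 * (j : ℕ)) ^ 2 / 2) * 0.9998 ≤
      ∑ j : Fin 8, Real.exp (-(t - 4.84 + 1.21 * (j : ℕ)) ^ 2 / 2) *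
        (t - 4.84 + 1.21 * (j : ℕ) - b) ^ 2 := by
  obtain ⟨Q, hQ⟩ : ∃ Q, Q = Real.exp (-1.4641) := ⟨_, rfl⟩
  obtain ⟨u, hu⟩ : ∃ u, u = Real.exp (1.4641 / 2 - 1.21 * t) := ⟨_, rfl⟩
  obtain ⟨A, hA⟩ : ∃ A, A = Real.exp (-(t - 4.84) ^ 2 / 2 + 6 * 1.4641) := ⟨_, rfl⟩
  have hA₀ : 0 < A := hA ▸ Real.exp_pos _
  have hu' : 0 < u := hu ▸ Real.exp_pos _
  have hQ' : 0 < Q := hQ ▸ Real.exp_pos _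
  obtain ⟨hQ₀, hQ₁⟩ := exp_neg_bounds
  rw [← hQ] at hQ₀ hQ₁
  have hsq : Real.exp (-1.4641 / 2) ^ 2 = Q := by
    rw [hQ, ← Real.exp_nat_mul]; norm_num
  have hhalf : 0.48 ≤ Real.exp (-1.4641 / 2) := by
    refine le_of_sq_le_sq (by rw [hsq]; linarith) (Real.exp_pos _).le
  have hu₀ : 0.47 ≤ u := by
    have : Real.exp (-1.4641 / 2) ≤ u := by rw [hu]; gcongr; linarith
    linarith
  have hu₁ : u ≤ 2.13 := by
    have h1 : u * Real.exp (-1.4641 / 2) ≤ 1 := by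
      rw [hu, ← Real.exp_add, Real.exp_le_one_iff]; linarith
    nlinarith
  have key := variance_certificate_nonneg hQ₀ hQ₁ hu₀ hu₁
  -- Completing the square with `1.4641 = 1.21 ^ 2` and `4.84 = 4 * 1.21`: the exponent `(j - 3) *
  -- (j - 4) / 2` of `Q` is symmetric under `j ↦ 7 - j`.
  have hw : ∀ j q : ℕ, (q : ℝ) * 2 = ((j : ℝ) - 3) * (j - 4) →
      Real.exp (-(t - 4.84 + 1.21 * (j : ℝ)) ^ 2 / 2) = A * (Q ^ q * u ^ j) := by
    intro j q h
    rw [hA, hQ, hu, ← Real.exp_nat_mul, ← Real.exp_nat_mul, ← Real.exp_add, ← Real.exp_add]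
    congr 1
    linear_combination 1.4641 / 2 * h
  have w0 := hw 0 6 (by norm_num)
  have w1 := hw 1 3 (by norm_num)
  have w2 := hw 2 1 (by norm_num)
  have w3 := hw 3 0 (by norm_num)
  have w4 := hw 4 0 (by norm_num)
  have w5 := hw 5 1 (by norm_num)
  have w6 := hw 6 3 (by norm_num)
  have w7 := hw 7 6 (by norm_num)
  have hS₀ : 0 < 1.4641 * (Q ^ 6 + Q ^ 3 * u + Q * u ^ 2 + u ^ 3 + u ^ 4 + Q * u ^ 5 + Q ^ 3 * u ^ 6
        + Q ^ 6 * u ^ 7) := by positivity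
  -- Lattice points are measured in units of the mesh, so `b` becomes `(b - t + 4.84) / 1.21` and
  -- `0.9998` is divided by `1.21 ^ 2`.
  have fin := quadratic_nonneg_of_moments (c := 0.9998 / 1.4641) (S₁ := 1.4641 * (Q ^ 3 * u + 2 * (Q * u ^ 2) + 3 * u ^ 3 + 4 * u ^ 4 + 5 * (Q * u ^ 5)
          + 6 * (Q ^ 3 * u ^ 6) + 7 * (Q ^ 6 * u ^ 7)))
    (S₂ := 1.4641 * (Q ^ 3 * u + 4 * (Q * u ^ 2) + 9 * u ^ 3 + 16 * u ^ 4
          + 25 * (Q * u ^ 5) + 36 * (Q ^ 3 * u ^ 6) + 49 * (Q ^ 6 * u ^ 7))) hS₀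
    (by linear_combination 1.4641 * key) ((b - t + 4.84) / 1.21)
  simp only [Fin.sum_univ_eight]
  simp only [Fin.coe_ofNat_eq_mod]
  norm_num only [Nat.cast_zero] at w0 w1 w2 w3 w4 w5 w6 w7 ⊢
  rw [w0, w1, w2, w3, w4, w5, w6, w7]
  refine sub_nonneg.1 ((mul_nonneg hA₀.le fin).trans_eq ?_)
  ring

/-! ### Shift and mirror as a bijection of the line -/

lemma modIco_eq_toIcoMod {a b : ℝ} (h : 0 < b - a) (r : ℝ) : modIco a b r = toIcoMod h a r := by
  rw [modIco, toIcoMod, toIcoDiv_eq_floor, zsmul_eq_mul]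

lemma modIco_mem {a b : ℝ} (h : a < b) (r : ℝ) : modIco a b r ∈ Set.Ico a b := by
  rw [modIco_eq_toIcoMod (sub_pos.2 h)]
  simpa using toIcoMod_mem_Ico (sub_pos.2 h) a r

lemma modIco_eq_of_mem {a b c r : ℝ} (h : a < b) (hc : c ∈ Set.Ico a b) (m : ℤ)
    (hr : r = c + m * (b - a)) : modIco a b r = c := by
  rw [modIco_eq_toIcoMod (sub_pos.2 h), toIcoMod_eq_iff]
  exact ⟨by simpa using hc, m, by simpa using hr⟩

lemma modIco_modIco_add_add_neg {a b x : ℝ} (h : a < b) (hx : x ∈ Set.Ico a b) (c : ℝ) :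
    modIco a b (modIco a b (x + c) + -c) = x :=
  modIco_eq_of_mem h hx (-⌊(x + c - a) / (b - a)⌋) (by rw [modIco]; push_cast; ring)

lemma measurable_modIco (a b : ℝ) : Measurable (modIco a b) := by
  unfold modIco; fun_prop

open Classical in
/-- Shift cyclically by `c` inside `[-θ, θ)`, and reflect outside of `[-θ, θ]` if `b` holds. -/
noncomputable def shiftMirror (θ c : ℝ) (b : Prop) (x : ℝ) : ℝ :=
  if x ∈ Set.Ico (-θ) θ then modIco (-θ) θ (x + c) else if θ < |x| ∧ b then -x else x

section

variable {θ : ℝ} {c : ℝ} {b : Prop}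

lemma shiftMirror_of_mem {x : ℝ} (hx : x ∈ Set.Ico (-θ) θ) :
    shiftMirror θ c b x = modIco (-θ) θ (x + c) := if_pos hx

lemma notMem_Ico_of_lt_abs {x : ℝ} (hx : θ < |x|) : x ∉ Set.Ico (-θ) θ := fun h ↦
  hx.not_ge (abs_le.2 ⟨h.1, h.2.le⟩)

lemma shiftMirror_of_lt_abs {x : ℝ} (hx : θ < |x|) (hb : b) : shiftMirror θ c b x = -x := by
  rw [shiftMirror, if_neg (notMem_Ico_of_lt_abs hx), if_pos ⟨hx, hb⟩]

lemma shiftMirror_of_lt_abs_of_not {x : ℝ} (hx : θ < |x|) (hb : ¬ b) :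
    shiftMirror θ c b x = x := by
  rw [shiftMirror, if_neg (notMem_Ico_of_lt_abs hx), if_neg (fun h ↦ hb h.2)]

lemma shiftMirror_self (hθ : 0 < θ) : shiftMirror θ c b θ = θ := by
  rw [shiftMirror, if_neg (by simp), if_neg (by simp [abs_of_pos hθ])]

lemma eq_of_notMem_Ico {x : ℝ} (hx : x ∉ Set.Ico (-θ) θ) (h : ¬ θ < |x|) : x = θ := by
  rw [not_lt, abs_le] at h
  by_contra hne
  exact hx ⟨h.1, lt_of_le_of_ne h.2 hne⟩

lemma shiftMirror_shiftMirror_neg (hθ : 0 < θ) (x : ℝ) :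
    shiftMirror θ (-c) b (shiftMirror θ c b x) = x := by
  by_cases hx : x ∈ Set.Ico (-θ) θ
  · rw [shiftMirror_of_mem hx, shiftMirror_of_mem (modIco_mem (by linarith) _),
      modIco_modIco_add_add_neg (by linarith) hx]
  · by_cases h : θ < |x|
    · by_cases hb : b
      · rw [shiftMirror_of_lt_abs h hb, shiftMirror_of_lt_abs (by rwa [abs_neg]) hb, neg_neg]
      · rw [shiftMirror_of_lt_abs_of_not h hb, shiftMirror_of_lt_abs_of_not h hb]
    · rw [eq_of_notMem_Ico hx h, shiftMirror_self hθ, shiftMirror_self hθ]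

lemma shiftMirror_neg_shiftMirror (hθ : 0 < θ) (x : ℝ) :
    shiftMirror θ c b (shiftMirror θ (-c) b x) = x := by
  simpa using shiftMirror_shiftMirror_neg (c := -c) (b := b) hθ x

lemma measurable_shiftMirror : Measurable (shiftMirror θ c b) := by
  classical
  unfold shiftMirror
  refine Measurable.ite measurableSet_Ico ((measurable_modIco _ _).comp (by fun_prop)) ?_
  refine Measurable.ite ?_ measurable_neg measurable_id
  exact (measurableSet_lt measurable_const measurable_norm).inter (MeasurableSet.const b)

end

/-! ### Preservation of Lebesgue measure -/

/-- A measurable bijection that agrees pointwise with one of countably many injective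
measure-preserving maps is measure-preserving. -/
lemma measurePreserving_of_piecewise {α ι : Type*} [MeasurableSpace α] {μ : Measure α}
    [Countable ι] [MeasurableSpace ι] [MeasurableSingletonClass ι] {f e : α → α}
    (hf : Measurable f) (he : Measurable e) (hef : Function.LeftInverse e f)
    (hfe : Function.RightInverse e f) {g : ι → α → α}
    (hg : ∀ i, MeasurePreserving (g i) μ μ) (hinj : ∀ i, Function.Injective (g i)) {i : α → ι}
    (hi : Measurable i) (hfg : ∀ x, f x = g (i x) x) : MeasurePreserving f μ μ := by
  refine ⟨hf, Measure.ext fun s hs ↦ ?_⟩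
  rw [Measure.map_apply hf hs]
  have hA : ∀ k, MeasurableSet (i ⁻¹' {k}) := fun k ↦ hi (measurableSet_singleton k)
  have hdis : Pairwise (Function.onFun Disjoint fun k ↦ i ⁻¹' {k}) := fun k l hkl ↦
    Disjoint.preimage _ (by simpa using hkl)
  have h1 : f ⁻¹' s = ⋃ k, (f ⁻¹' s ∩ i ⁻¹' {k}) := by
    ext x; simp
  have h2 : s = ⋃ k, (s ∩ e ⁻¹' (i ⁻¹' {k})) := by
    ext x; simp
  -- The sets `e ⁻¹' (i ⁻¹' {k})` are the images of the pieces under `f`. If `g k x` lies in the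
  -- `k`-th image, then `f` and `g k` agree at `e (g k x)`, and injectivity of `g k` gives `e (g k
  -- x) = x`, so `x` lies in the `k`-th piece.
  have h3 : ∀ k, f ⁻¹' s ∩ i ⁻¹' {k} = g k ⁻¹' (s ∩ e ⁻¹' (i ⁻¹' {k})) := by
    intro k
    ext x
    constructor
    · rintro ⟨hx, rfl⟩
      rw [Set.mem_preimage, ← hfg]
      exact ⟨hx, by simp [hef x]⟩
    · rintro ⟨hx, hk⟩
      have hk' : i (e (g k x)) = k := hk
      have h4 : g k (e (g k x)) = g k x := by
        have h := hfg (e (g k x))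
        rw [hfe, hk'] at h
        exact h.symm
      have h5 := hinj k h4
      rw [h5] at hk'
      refine ⟨?_, hk'⟩
      rw [Set.mem_preimage, hfg, hk']
      exact hx
  rw [h1, measure_iUnion (fun k l hkl ↦ (hdis hkl).mono Set.inter_subset_right
      Set.inter_subset_right) (fun k ↦ (hf hs).inter (hA k))]
  conv_rhs => rw [h2, measure_iUnion (fun k l hkl ↦ ((hdis hkl).preimage e).mono
      Set.inter_subset_right Set.inter_subset_right) (fun k ↦ hs.inter (he (hA k)))]
  exact tsum_congr fun k ↦ by
    rw [h3, (hg k).measure_preimage (hs.inter (he (hA k))).nullMeasurableSet]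

lemma measurePreserving_shiftMirror {θ : ℝ} (hθ : 0 < θ) (c : ℝ) (b : Prop) :
    MeasurePreserving (shiftMirror θ c b) volume volume := by
  classical
  -- The `Fin 3` label selects translation, reflection or identity; the integer counts the windows
  -- subtracted by the reduction modulo `2 * θ`.
  let g : ℤ × Fin 3 → ℝ → ℝ := fun k ↦
    if k.2 = 0 then fun x ↦ x + (c - k.1 * (θ - -θ)) else if k.2 = 1 then fun x ↦ -x
    else fun x ↦ x
  refine measurePreserving_of_piecewise (ι := ℤ × Fin 3) (g := g)
    (i := fun x ↦ if x ∈ Set.Ico (-θ) θ then (⌊(x + c - -θ) / (θ - -θ)⌋, 0)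
      else if θ < |x| ∧ b then (0, 1) else (0, 2)) measurable_shiftMirror measurable_shiftMirror
    (fun x ↦ shiftMirror_shiftMirror_neg hθ x) (fun x ↦ shiftMirror_neg_shiftMirror hθ x)
    (fun k ↦ ?_) (fun k ↦ ?_) ?_ fun x ↦ ?_
  · simp only [g]
    split_ifs
    · exact measurePreserving_add_right volume _
    · exact Measure.measurePreserving_neg volume
    · exact MeasurePreserving.id volume
  · simp only [g]
    split_ifs
    · exact add_left_injective _
    · exact neg_injective
    · exact Function.injective_id
  · refine Measurable.ite measurableSet_Ico ?_ (Measurable.ite ?_ measurable_const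
      measurable_const)
    · fun_prop
    · exact (measurableSet_lt measurable_const measurable_norm).inter (MeasurableSet.const b)
  · simp only [shiftMirror]
    split_ifs with h1 h2
    · simp [g, modIco]; ring
    · simp [g]
    · simp [g]

section

variable {k : ℕ} {θ : ℝ}

lemma scalarEnc_eq (x : ℝ) (κ : Fin k → Bool) : scalarEnc θ x κ =
    shiftMirror θ (keyValue κ * (2 * θ / 2 ^ k)) (2 ^ (k - 1) ≤ keyValue κ) x := by
  unfold scalarEnc shiftMirror
  congr

lemma scalarDec_eq (x : ℝ) (κ : Fin k → Bool) : scalarDec θ x κ =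
    shiftMirror θ (-(keyValue κ * (2 * θ / 2 ^ k))) (2 ^ (k - 1) ≤ keyValue κ) x := by
  unfold scalarDec shiftMirror
  rw [← sub_eq_add_neg]
  congr

lemma scalarDec_scalarEnc (hθ : 0 < θ) (x : ℝ) (κ : Fin k → Bool) :
    scalarDec θ (scalarEnc θ x κ) κ = x := by
  rw [scalarDec_eq, scalarEnc_eq, shiftMirror_shiftMirror_neg hθ]

lemma scalarEnc_scalarDec (hθ : 0 < θ) (x : ℝ) (κ : Fin k → Bool) :
    scalarEnc θ (scalarDec θ x κ) κ = x := by
  rw [scalarDec_eq, scalarEnc_eq, shiftMirror_neg_shiftMirror hθ]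

lemma measurable_scalarEnc (κ : Fin k → Bool) : Measurable fun x ↦ scalarEnc θ x κ := by
  simp_rw [scalarEnc_eq]
  exact measurable_shiftMirror

lemma measurePreserving_scalarDec (hθ : 0 < θ) (κ : Fin k → Bool) :
    MeasurePreserving (fun x ↦ scalarDec θ x κ) volume volume := by
  simp_rw [scalarDec_eq]
  exact measurePreserving_shiftMirror hθ _ _

lemma lintegral_mul_comp_scalarEnc (hθ : 0 < θ) (κ : Fin k → Bool) {G w : ℝ → ℝ≥0∞}
    (hG : Measurable G) (hw : Measurable w) :
    ∫⁻ y, G y * w (scalarEnc θ y κ) = ∫⁻ z, G (scalarDec θ z κ) * w z := by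
  refine ((measurePreserving_scalarDec hθ κ).lintegral_comp
    (hG.mul (hw.comp (measurable_scalarEnc κ)))).symm.trans ?_
  simp [scalarEnc_scalarDec hθ]

end

/-! ### The eight sources of a packet -/

lemma sum_key_eq (F : ℕ → ℝ) : ∑ κ : Fin 3 → Bool, F (keyValue κ) = ∑ j : Fin 8, F j := by
  have h : Function.Bijective fun κ : Fin 3 → Bool ↦ (⟨keyValue κ, by
      revert κ; decide⟩ : Fin 8) := by
    decide
  exact Fintype.sum_bijective _ h _ _ fun κ ↦ rfl

/-- The sources of a packet `z` in the window, over all keys, form a translate of a lattice of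
mesh `1.21`. -/
lemma sum_scalarDec_of_mem {z : ℝ} (hz : z ∈ Set.Ico (-4.84 : ℝ) 4.84) :
    ∃ t, 0 ≤ t ∧ t ≤ 1.21 ∧ ∀ F : ℝ → ℝ, ∑ κ : Fin 3 → Bool, F (scalarDec 4.84 z κ) =
      ∑ j : Fin 8, F (t - 4.84 + 1.21 * (j : ℕ)) := by
  obtain ⟨hz1, hz2⟩ := hz
  obtain ⟨k, hk⟩ : ∃ k, k = ⌊(z + 4.84) / 1.21⌋ := ⟨_, rfl⟩
  have h1 := Int.floor_le ((z + 4.84) / 1.21)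
  have h2 := Int.lt_floor_add_one ((z + 4.84) / 1.21)
  rw [← hk] at h1 h2
  have hk0 : 0 ≤ k := hk ▸ Int.floor_nonneg.2 (div_nonneg (by linarith) (by norm_num))
  have hk8 : k < 8 := hk ▸ Int.floor_lt.2 (by rw [div_lt_iff₀ (by norm_num)]; norm_num; linarith)
  rw [le_div_iff₀ (by norm_num)] at h1
  rw [div_lt_iff₀ (by norm_num)] at h2
  -- Cut the window into eight cells of length `1.21`. Here `k` is the cell of `z` and `t` its
  -- offset there; decoding with key `j` moves to cell `k - j` modulo 8, at the same offset.
  refine ⟨z + 4.84 - k * 1.21, by linarith, by linarith, fun F ↦ ?_⟩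
  have hs : ∀ κ : Fin 3 → Bool, scalarDec 4.84 z κ =
      modIco (-4.84) 4.84 (z - (keyValue κ : ℕ) * 1.21) := by
    intro κ
    rw [scalarDec, if_pos ⟨hz1, hz2⟩]
    norm_num
  simp_rw [hs]
  rw [sum_key_eq fun j ↦ F (modIco (-4.84) 4.84 (z - j * 1.21))]
  lift k to ℕ using hk0
  have hk8' : k < 8 := by exact_mod_cast hk8
  refine Fintype.sum_equiv (Equiv.subLeft (⟨k, hk8'⟩ : Fin 8)) _ _ fun j ↦ ?_
  congr 1
  simp only [Equiv.subLeft_apply, Fin.val_sub, Int.cast_natCast] at h1 h2 ⊢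
  have hj := j.isLt
  obtain ⟨r, hr⟩ : ∃ r, r = (8 - (j : ℕ) + k) % 8 := ⟨_, rfl⟩
  rw [← hr]
  have hr8 : (r : ℝ) ≤ 7 := by exact_mod_cast (by omega : r ≤ 7)
  have hr0 : (0 : ℝ) ≤ r := r.cast_nonneg
  have hm : ∃ m : ℤ, (k : ℤ) - (j : ℕ) = r + 8 * m := by
    rcases le_or_gt (j : ℕ) k with h | h
    · exact ⟨0, by omega⟩
    · exact ⟨-1, by omega⟩
  obtain ⟨m, hm⟩ := hm
  have hm' : (k : ℝ) - (j : ℕ) = r + 8 * m := by exact_mod_cast hm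
  refine modIco_eq_of_mem (by norm_num) ⟨by linarith, by linarith⟩ m ?_
  linear_combination 1.21 * hm'

/-- The point `4.84` is excluded because every key fixes it: its source is known and has variance
zero. -/
lemma gaussian_key_second_moment {z : ℝ} (hz : z ≠ 4.84) (b : ℝ) :
    ∑ κ : Fin 3 → Bool, Real.exp (-(scalarDec 4.84 z κ) ^ 2 / 2) * 0.9998 ≤
      ∑ κ : Fin 3 → Bool, Real.exp (-(scalarDec 4.84 z κ) ^ 2 / 2) *
        (scalarDec 4.84 z κ - b) ^ 2 := by
  by_cases hmem : z ∈ Set.Ico (-4.84 : ℝ) 4.84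
  · obtain ⟨t, h0, h1, h⟩ := sum_scalarDec_of_mem hmem
    rw [h fun x ↦ Real.exp (-x ^ 2 / 2) * 0.9998, h fun x ↦ Real.exp (-x ^ 2 / 2) * (x - b) ^ 2]
    exact gaussian_lattice_second_moment h0 h1 b
  · have habs : 4.84 < |z| := by
      by_contra h
      exact hz (eq_of_notMem_Ico hmem h)
    have hs : ∀ κ : Fin 3 → Bool, scalarDec 4.84 z κ = if 4 ≤ keyValue κ then -z else z := by
      intro κ
      rw [scalarDec, if_neg hmem]
      simp [habs]
    simp_rw [hs]
    rw [sum_key_eq fun j ↦ Real.exp (-(if 4 ≤ j then -z else z) ^ 2 / 2) * 0.9998,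
      sum_key_eq fun j ↦ Real.exp (-(if 4 ≤ j then -z else z) ^ 2 / 2) *
        ((if 4 ≤ j then -z else z) - b) ^ 2]
    have hz2 : (4.84 : ℝ) ^ 2 ≤ z ^ 2 := by
      rw [← sq_abs z]; exact pow_le_pow_left₀ (by norm_num) habs.le 2
    simp only [Fin.sum_univ_eight, Fin.coe_ofNat_eq_mod]
    norm_num only [neg_sq, if_true, if_false]
    -- Four keys give `z` and four give `-z`, so the cross terms in `b` cancel and the mean square
    -- about `b` is `z ^ 2 + b ^ 2`.
    have := mul_nonneg (Real.exp_pos (-z ^ 2 / 2)).le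
      (by nlinarith [sq_nonneg b] : 0 ≤ z ^ 2 + b ^ 2 - 0.9998)
    norm_num only at this
    linear_combination 8 * this

/-! ### The scalar bound integrated against packet weights -/

/-- Changing variables to the packet for each key puts all keys over the same `z`, where they can be
compared pointwise. -/
lemma sum_lintegral_gaussianReal_scalarEnc {k : ℕ} {θ : ℝ} (hθ : 0 < θ) {G w : ℝ → ℝ≥0∞}
    (hG : Measurable G) (hw : Measurable w) :
    ∑ κ : Fin k → Bool, ∫⁻ y, G y * w (scalarEnc θ y κ) ∂(gaussianReal 0 1) =
      ∫⁻ z, (∑ κ : Fin k → Bool, gaussianPDF 0 1 (scalarDec θ z κ) * G (scalarDec θ z κ)) * w z := by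
  simp_rw [Finset.sum_mul]
  rw [lintegral_finsetSum]
  · refine Finset.sum_congr rfl fun κ _ ↦ ?_
    rw [gaussianReal_of_var_ne_zero _ one_ne_zero]
    refine (lintegral_withDensity_eq_lintegral_mul _
      (measurable_gaussianPDF 0 1) (hG.mul (hw.comp (measurable_scalarEnc κ)))).trans ?_
    rw [← lintegral_mul_comp_scalarEnc hθ κ (G := fun y ↦ gaussianPDF 0 1 y * G y)
      ((measurable_gaussianPDF 0 1).mul hG) hw]
    simp [mul_assoc]
  · intro κ _
    have := (measurePreserving_scalarDec hθ κ).measurable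
    exact (((measurable_gaussianPDF 0 1).comp this).mul (hG.comp this)).mul hw

/-- Given the packet, the second moment of a standard Gaussian about any point is at least
`0.9998`: a version integrated against a weight depending on the packet. -/
lemma standardGaussian_scalarEnc_second_moment (b : ℝ) {w : ℝ → ℝ≥0∞} (hw : Measurable w) :
    ∑ κ : Fin 3 → Bool, ∫⁻ y, ENNReal.ofReal 0.9998 * w (scalarEnc 4.84 y κ) ∂(gaussianReal 0 1) ≤
      ∑ κ : Fin 3 → Bool, ∫⁻ y, ENNReal.ofReal ((y - b) ^ 2) * w (scalarEnc 4.84 y κ)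
        ∂(gaussianReal 0 1) := by
  rw [sum_lintegral_gaussianReal_scalarEnc (by norm_num) measurable_const hw,
    sum_lintegral_gaussianReal_scalarEnc (by norm_num) (by fun_prop) hw]
  refine lintegral_mono_ae ?_
  filter_upwards [compl_mem_ae_iff.2 (measure_singleton (μ := volume) (4.84 : ℝ))] with z hz
  refine mul_le_mul_left ?_ _
  simp_rw [gaussianPDF, ← ENNReal.ofReal_mul (gaussianPDFReal_nonneg _ _ _)]
  rw [← ENNReal.ofReal_sum_of_nonneg fun _ _ ↦
      mul_nonneg (gaussianPDFReal_nonneg _ _ _) (by norm_num),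
    ← ENNReal.ofReal_sum_of_nonneg fun _ _ ↦
      mul_nonneg (gaussianPDFReal_nonneg _ _ _) (sq_nonneg _)]
  refine ENNReal.ofReal_le_ofReal ?_
  simp only [gaussianPDFReal, sub_zero, NNReal.coe_one, mul_one, mul_assoc, ← Finset.mul_sum]
  exact mul_le_mul_of_nonneg_left (gaussian_key_second_moment hz b) (by positivity)

lemma gaussian_scalarEnc_second_moment (m a : ℝ) {v : ℝ} (hv : 0 ≤ v) {w : ℝ → ℝ≥0∞}
    (hw : Measurable w) :
    ∑ κ : Fin 3 → Bool, ∫⁻ y, ENNReal.ofReal (0.9998 * v) * w (scalarEnc 4.84 ((y - m) / √v) κ)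
        ∂(gaussianReal m v.toNNReal) ≤
      ∑ κ : Fin 3 → Bool, ∫⁻ y, ENNReal.ofReal ((y - a) ^ 2) *
        w (scalarEnc 4.84 ((y - m) / √v) κ) ∂(gaussianReal m v.toNNReal) := by
  rcases hv.eq_or_lt with rfl | hv
  · simp
  have hs : 0 < √v := Real.sqrt_pos.2 hv
  have hmap : gaussianReal m v.toNNReal = (gaussianReal 0 1).map fun y ↦ m + √v * y := by
    have h := gaussianReal_map_const_mul (μ := 0) (v := 1) (√v)
    have h' := gaussianReal_map_const_add (μ := √v * 0) (v := .mk (√v ^ 2) (sq_nonneg _) * 1) m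
    rw [← h, Measure.map_map (by fun_prop) (by fun_prop)] at h'
    rw [show (fun y ↦ m + √v * y) = (fun x ↦ m + x) ∘ fun x ↦ √v * x from rfl, h']
    congr 1
    · simp
    · ext; simp [Real.sq_sqrt hv.le, hv.le]
  have hm : ∀ κ : Fin 3 → Bool, Measurable fun y ↦ w (scalarEnc 4.84 ((y - m) / √v) κ) :=
    fun κ ↦ hw.comp ((measurable_scalarEnc κ).comp (by fun_prop))
  have hm' : ∀ κ : Fin 3 → Bool, Measurable fun y ↦ w (scalarEnc 4.84 y κ) :=
    fun κ ↦ hw.comp (measurable_scalarEnc κ)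
  have hq : ∀ c, Measurable fun y : ℝ ↦ ENNReal.ofReal ((y - c) ^ 2) := fun c ↦ by fun_prop
  have hsc := mul_le_mul_right (standardGaussian_scalarEnc_second_moment ((a - m) / √v) hw)
    (ENNReal.ofReal v)
  simp_rw [Finset.mul_sum] at hsc
  convert hsc using 3 with κ _ κ _
  · rw [hmap, lintegral_map ((hm κ).const_mul _) (by fun_prop),
      ← lintegral_const_mul _ ((hm' κ).const_mul _)]
    refine lintegral_congr fun y ↦ ?_
    rw [← mul_assoc, ← ENNReal.ofReal_mul hv.le, mul_comm v]
    simp [hs.ne']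
  · rw [hmap, lintegral_map ((hq _).fun_mul (hm κ)) (by fun_prop),
      ← lintegral_const_mul _ ((hq _).fun_mul (hm' κ))]
    refine lintegral_congr fun y ↦ ?_
    rw [← mul_assoc, ← ENNReal.ofReal_mul hv.le]
    congr 2
    · nth_rw 2 [← Real.sq_sqrt hv.le]
      rw [← mul_pow, mul_sub, mul_div_cancel₀ _ hs.ne']
      ring
    · simp [hs.ne']

/-! ### From one coordinate to vectors -/

lemma multivariateGaussian_eq_map_pi {n : ℕ} (μ : EuclideanSpace ℝ (Fin n))
    {S : Matrix (Fin n) (Fin n) ℝ} (hS : S.PosSemidef) (hdiag : S.IsDiag) :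
    multivariateGaussian μ S =
      (Measure.pi fun i ↦ gaussianReal (μ i) (S i i).toNNReal).map (WithLp.toLp 2) := by
  refine Measure.ext_of_charFun (funext fun t ↦ ?_)
  rw [charFun_multivariateGaussian hS, charFun_pi]
  simp_rw [charFun_gaussianReal, ← Complex.exp_sum]
  congr 1
  have hquad : t.ofLp ⬝ᵥ S.mulVec t.ofLp = ∑ i, S i i * t i ^ 2 := by
    rw [← hdiag.diagonal_diag]
    simp [dotProduct, Matrix.mulVec_diagonal]
    exact Finset.sum_congr rfl fun i _ ↦ by ring
  simp only [hquad, PiLp.inner_apply, Finset.sum_sub_distrib]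
  push_cast
  rw [Finset.sum_mul, Finset.sum_div]
  congr 1
  · exact Finset.sum_congr rfl fun i _ ↦ by simp [mul_comm]
  · refine Finset.sum_congr rfl fun i _ ↦ ?_
    rw [Real.coe_toNNReal _ (hS.diag_nonneg)]

/-- Keys are grouped by their coordinates other than `i`; each group is one hypothesis, based at any
of its members. -/
lemma sum_le_sum_of_sum_update_le {ι β : Type*} [Fintype ι] [DecidableEq ι] [Fintype β]
    (i : ι) {f g : (ι → β) → ℝ≥0∞}
    (h : ∀ K, ∑ κ, f (Function.update K i κ) ≤ ∑ κ, g (Function.update K i κ)) :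
    ∑ K, f K ≤ ∑ K, g K := by
  have hs : ∀ f : (ι → β) → ℝ≥0∞, ∑ K, f K = ∑ L : ({j // j ≠ i} → β), ∑ κ,
      f ((Equiv.funSplitAt i β).symm (κ, L)) := by
    intro f
    rw [← Fintype.sum_prod_type', ← (Equiv.prodComm _ _).sum_comp]
    exact ((Equiv.funSplitAt i β).symm.sum_comp f).symm
  rw [hs f, hs g]
  refine Finset.sum_le_sum fun L _ ↦ ?_
  rcases isEmpty_or_nonempty β with hβ | ⟨⟨b⟩⟩
  · simp
  have hu : ∀ κ, (Equiv.funSplitAt i β).symm (κ, L) =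
      Function.update ((Equiv.funSplitAt i β).symm (b, L)) i κ := by
    intro κ
    ext j
    rcases eq_or_ne j i with rfl | hj
    · rw [Equiv.funSplitAt_symm_apply, Function.update_self, dif_pos rfl]
    · rw [Equiv.funSplitAt_symm_apply, Function.update_of_ne hj, Equiv.funSplitAt_symm_apply,
        dif_neg hj, dif_neg hj]
  simpa only [← hu] using h ((Equiv.funSplitAt i β).symm (b, L))

lemma lintegral_uniformOn_univ {α : Type*} [Fintype α] [MeasurableSpace α]
    [MeasurableSingletonClass α] (f : α → ℝ≥0∞) :
    ∫⁻ x, f x ∂(uniformOn Set.univ) = (∑ x, f x) * (Fintype.card α : ℝ≥0∞)⁻¹ := by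
  rw [lintegral_fintype, Finset.sum_mul]
  refine Finset.sum_congr rfl fun x _ ↦ ?_
  rw [uniformOn_univ, Measure.count_singleton, one_div]

lemma lintegral_comp_indepFun_uniformOn {Ω E α : Type*} [MeasurableSpace Ω] {P : Measure Ω}
    [IsProbabilityMeasure P] [MeasurableSpace E] [Fintype α] [MeasurableSpace α]
    [MeasurableSingletonClass α] {ν : Measure E} {X : Ω → E} {K : Ω → α} (hX : HasLaw X ν P)
    (hK : HasLaw K (uniformOn Set.univ) P) (hXK : IndepFun X K P) {f : E → α → ℝ≥0∞}
    (hf : ∀ k, Measurable fun x ↦ f x k) :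
    ∫⁻ ω, f (X ω) (K ω) ∂P = (∑ k, ∫⁻ x, f x k ∂ν) * (Fintype.card α : ℝ≥0∞)⁻¹ := by
  have : IsProbabilityMeasure ν := hX.map_eq ▸ Measure.isProbabilityMeasure_map hX.aemeasurable
  have : IsProbabilityMeasure (uniformOn (Set.univ : Set α)) :=
    hK.map_eq ▸ Measure.isProbabilityMeasure_map hK.aemeasurable
  have hjoint := (indepFun_iff_map_prod_eq_prod_map_map hX.aemeasurable hK.aemeasurable).1 hXK
  rw [hX.map_eq, hK.map_eq] at hjoint
  have hm : Measurable fun p : E × α ↦ f p.1 p.2 := measurable_from_prod_countable_left hf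
  have h1 := lintegral_map' (μ := P) hm.aemeasurable (hX.aemeasurable.prodMk hK.aemeasurable)
  rw [← h1, hjoint, lintegral_prod_symm _ hm.aemeasurable, lintegral_uniformOn_univ]

section

variable {n k : ℕ} {θ : ℝ} {μ : EuclideanSpace ℝ (Fin n)} {S : Matrix (Fin n) (Fin n) ℝ}

lemma measurable_vectorEnc (κ : Fin n → Fin k → Bool) :
    Measurable fun x ↦ vectorEnc θ μ S x κ := by
  refine (WithLp.measurable_toLp 2 _).comp (measurable_pi_lambda _ fun i ↦ ?_)
  exact (measurable_scalarEnc (κ i)).comp (by fun_prop)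

lemma measurable_vectorEnc_uncurry :
    Measurable fun p : EuclideanSpace ℝ (Fin n) × (Fin n → Fin k → Bool) ↦
      vectorEnc θ μ S p.1 p.2 :=
  measurable_from_prod_countable_left measurable_vectorEnc

lemma vectorEnc_update (x : Fin n → ℝ) (κ : Fin n → Fin k → Bool) (i : Fin n) (y : ℝ)
    (l : Fin k → Bool) :
    vectorEnc θ μ S (WithLp.toLp 2 (Function.update x i y)) (Function.update κ i l) =
      WithLp.toLp 2 (Function.update (vectorEnc θ μ S (WithLp.toLp 2 x) κ).ofLp i
        (scalarEnc θ ((y - μ i) / √(S i i)) l)) := by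
  unfold vectorEnc
  congr 1
  ext j
  by_cases hj : j = i
  · subst hj; simp
  · simp [hj]

end

lemma lintegral_update_coordinate_second_moment {n : ℕ} {μ : EuclideanSpace ℝ (Fin n)}
    {S : Matrix (Fin n) (Fin n) ℝ} (hS : S.PosSemidef) {w : EuclideanSpace ℝ (Fin n) → ℝ≥0∞}
    (hw : Measurable w) (i : Fin n) (a : ℝ) (x : Fin n → ℝ) :
    ∫⁻ y, ∑ κ : Fin n → Fin 3 → Bool, ENNReal.ofReal (0.9998 * S i i) *
      w (vectorEnc 4.84 μ S (WithLp.toLp 2 (Function.update x i y)) κ)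
        ∂gaussianReal (μ i) (S i i).toNNReal ≤
    ∫⁻ y, ∑ κ : Fin n → Fin 3 → Bool, ENNReal.ofReal ((Function.update x i y i - a) ^ 2) *
      w (vectorEnc 4.84 μ S (WithLp.toLp 2 (Function.update x i y)) κ)
        ∂gaussianReal (μ i) (S i i).toNNReal := by
  have htoLp : Measurable (WithLp.toLp 2 : (Fin n → ℝ) → EuclideanSpace ℝ (Fin n)) :=
    WithLp.measurable_toLp 2 _
  have hu : Measurable fun y : ℝ ↦ (WithLp.toLp 2 (Function.update x i y) :
      EuclideanSpace ℝ (Fin n)) := htoLp.comp (measurable_update x)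
  have hwu : ∀ κ : Fin n → Fin 3 → Bool, Measurable fun y : ℝ ↦
      w (vectorEnc 4.84 μ S (WithLp.toLp 2 (Function.update x i y)) κ) := fun κ ↦
    (hw.comp (measurable_vectorEnc κ)).comp hu
  have hqu : Measurable fun y : ℝ ↦ ENNReal.ofReal ((Function.update x i y i - a) ^ 2) := by
    simp only [Function.update_self]; fun_prop
  rw [lintegral_finsetSum _ fun κ _ ↦ (hwu κ).const_mul _,
    lintegral_finsetSum _ fun κ _ ↦ hqu.fun_mul (hwu κ)]
  refine sum_le_sum_of_sum_update_le i fun κ ↦ ?_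
  simp only [vectorEnc_update, Function.update_self]
  exact gaussian_scalarEnc_second_moment (μ i) a hS.diag_nonneg
    (w := fun z ↦ w (WithLp.toLp 2 (Function.update
      (vectorEnc 4.84 μ S (WithLp.toLp 2 x) κ).ofLp i z)))
    (hw.comp (htoLp.comp (measurable_update _)))

lemma lintegral_coordinate_second_moment {Ω : Type*} [MeasurableSpace Ω] {P : Measure Ω}
    [IsProbabilityMeasure P] {n : ℕ} {μ : EuclideanSpace ℝ (Fin n)}
    {S : Matrix (Fin n) (Fin n) ℝ} (hS : S.PosSemidef) (hdiag : S.IsDiag)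
    {X : Ω → EuclideanSpace ℝ (Fin n)} (hX : HasLaw X (multivariateGaussian μ S) P)
    {K : Ω → Fin n → Fin 3 → Bool} (hK : HasLaw K (uniformOn Set.univ) P)
    (hXK : IndepFun X K P) {w : EuclideanSpace ℝ (Fin n) → ℝ≥0∞} (hw : Measurable w)
    (i : Fin n) (a : ℝ) :
    ∫⁻ ω, ENNReal.ofReal (0.9998 * S i i) * w (vectorEnc 4.84 μ S (X ω) (K ω)) ∂P ≤
      ∫⁻ ω, ENNReal.ofReal ((X ω i - a) ^ 2) * w (vectorEnc 4.84 μ S (X ω) (K ω)) ∂P := by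
  have hwe : ∀ κ : Fin n → Fin 3 → Bool, Measurable fun x ↦ w (vectorEnc 4.84 μ S x κ) :=
    fun κ ↦ hw.comp (measurable_vectorEnc κ)
  have hq : Measurable fun x : EuclideanSpace ℝ (Fin n) ↦ ENNReal.ofReal ((x i - a) ^ 2) := by
    fun_prop
  rw [lintegral_comp_indepFun_uniformOn hX hK hXK
      (f := fun x κ ↦ ENNReal.ofReal (0.9998 * S i i) * w (vectorEnc 4.84 μ S x κ))
      fun κ ↦ (hwe κ).const_mul _,
    lintegral_comp_indepFun_uniformOn hX hK hXK
      (f := fun x κ ↦ ENNReal.ofReal ((x i - a) ^ 2) * w (vectorEnc 4.84 μ S x κ))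
      fun κ ↦ hq.mul (hwe κ)]
  refine mul_le_mul_left ?_ _
  rw [← lintegral_finsetSum _ fun κ _ ↦ (hwe κ).const_mul _,
    ← lintegral_finsetSum _ fun κ _ ↦ hq.fun_mul (hwe κ)]
  have htoLp : Measurable (WithLp.toLp 2 : (Fin n → ℝ) → EuclideanSpace ℝ (Fin n)) :=
    WithLp.measurable_toLp 2 _
  have hL : Measurable fun x ↦ ∑ κ : Fin n → Fin 3 → Bool,
      ENNReal.ofReal (0.9998 * S i i) * w (vectorEnc 4.84 μ S x κ) :=
    Finset.measurable_fun_sum _ fun κ _ ↦ (hwe κ).const_mul _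
  have hR : Measurable fun x ↦ ∑ κ : Fin n → Fin 3 → Bool,
      ENNReal.ofReal ((x i - a) ^ 2) * w (vectorEnc 4.84 μ S x κ) :=
    Finset.measurable_fun_sum _ fun κ _ ↦ hq.mul (hwe κ)
  rw [multivariateGaussian_eq_map_pi μ hS hdiag, lintegral_map hL htoLp, lintegral_map hR htoLp]
  -- For diagonal `S` the law of `X` is a product, so it suffices to compare integrals over the
  -- `i`-th coordinate with the others fixed.
  refine lintegral_le_of_lmarginal_le {i} (hL.comp htoLp) (hR.comp htoLp) ?_
  rw [lmarginal_singleton, lmarginal_singleton]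
  intro x
  exact lintegral_update_coordinate_second_moment hS hw i a x

/-! ### Bounds on the worst-case distortion -/

lemma enorm_sub_sq_eq_sum {n : ℕ} (x a : EuclideanSpace ℝ (Fin n)) :
    ‖x - a‖ₑ ^ 2 = ∑ i, ENNReal.ofReal ((x i - a i) ^ 2) := by
  rw [← ofReal_norm, ← ENNReal.ofReal_pow (norm_nonneg _),
    EuclideanSpace.real_norm_sq_eq, ENNReal.ofReal_sum_of_nonneg fun _ _ ↦ sq_nonneg _]
  rfl

/-- For a probability measure, the mean squared distance to `a` is bounded below as soon as it is
for all `a` in a dense set. -/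
lemma le_lintegral_enorm_sub_sq_of_dense {E : Type*} [NormedAddCommGroup E] [MeasurableSpace E]
    [BorelSpace E] [SecondCountableTopology E] {ν : Measure E} [IsProbabilityMeasure ν]
    {D : Set E} (hD : Dense D) {c : ℝ≥0∞} (h : ∀ d ∈ D, c ≤ ∫⁻ x, ‖x - d‖ₑ ^ 2 ∂ν) (a : E) :
    c ≤ ∫⁻ x, ‖x - a‖ₑ ^ 2 ∂ν := by
  have hL : ∀ a : E, eLpNorm (fun x ↦ x - a) 2 ν ^ 2 = ∫⁻ x, ‖x - a‖ₑ ^ 2 ∂ν := by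
    intro a
    have := eLpNorm_nnreal_pow_eq_lintegral (f := fun x ↦ x - a) (μ := ν) (p := 2) two_ne_zero
    simpa using this
  have hm : ∀ a : E, AEStronglyMeasurable (fun x ↦ x - a) ν := fun a ↦ by fun_prop
  simp_rw [← hL] at h ⊢
  have hc : ∀ s : ℝ≥0∞, c ≤ s ^ 2 ↔ c ^ (2 : ℝ)⁻¹ ≤ s := by
    intro s
    rw [ENNReal.rpow_inv_le_iff two_pos, ENNReal.rpow_two]
  simp_rw [hc] at h ⊢
  refine ENNReal.le_of_forall_pos_le_add fun ε hε _ ↦ ?_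
  obtain ⟨d, hdD, hd⟩ := hD.exists_dist_lt a (NNReal.coe_pos.2 hε)
  refine (h d hdD).trans ?_
  -- Minkowski in `L²`: replacing the centre `a` by `d` changes the root mean square distance by at
  -- most the distance from `a` to `d`.
  have hadd := eLpNorm_add_le (hm a) (aestronglyMeasurable_const (b := a - d)) (p := 2)
    (by norm_num)
  have hfun : (fun x : E ↦ x - a) + (fun _ ↦ a - d) = fun x ↦ x - d := by
    ext x; simp
  rw [hfun, eLpNorm_const _ (by norm_num) (NeZero.ne ν)] at hadd
  refine hadd.trans (add_le_add le_rfl ?_)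
  simp only [measure_univ, ENNReal.one_rpow, mul_one]
  rw [← edist_eq_enorm_sub, edist_nndist]
  exact_mod_cast hd.le

section

variable {Ω : Type*} [MeasurableSpace Ω] {P : Measure Ω} [IsProbabilityMeasure P] {n : ℕ}
  {𝒵 : Type*} [MeasurableSpace 𝒵] {X : Ω → EuclideanSpace ℝ (Fin n)} {Z : Ω → 𝒵}

lemma measurable_enorm_sub_sq (a : EuclideanSpace ℝ (Fin n)) :
    Measurable fun x : EuclideanSpace ℝ (Fin n) ↦ ‖x - a‖ₑ ^ 2 := by fun_prop

lemma setLIntegral_lintegral_condDistrib (hX : AEMeasurable X P) (hZ : AEMeasurable Z P)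
    (a : EuclideanSpace ℝ (Fin n)) {A : Set 𝒵} (hA : MeasurableSet A) :
    ∫⁻ z in A, ∫⁻ x, ‖x - a‖ₑ ^ 2 ∂(condDistrib X Z P z) ∂(P.map Z) =
      ∫⁻ ω, ‖X ω - a‖ₑ ^ 2 * A.indicator 1 (Z ω) ∂P := by
  have hmap := lintegral_map' (μ := P) (g := fun ω ↦ (Z ω, X ω))
    (f := fun p ↦ ‖p.2 - a‖ₑ ^ 2 * A.indicator 1 p.1)
    (((measurable_enorm_sub_sq a).comp measurable_snd).mul
      ((measurable_one.indicator hA).comp measurable_fst)).aemeasurable (hZ.prodMk hX)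
  have hf : Measurable fun p : 𝒵 × EuclideanSpace ℝ (Fin n) ↦
      ‖p.2 - a‖ₑ ^ 2 * A.indicator 1 p.1 :=
    ((measurable_enorm_sub_sq a).comp measurable_snd).mul
      ((measurable_one.indicator hA).comp measurable_fst)
  rw [← hmap, ← compProd_map_condDistrib hX, Measure.lintegral_compProd hf,
    ← lintegral_indicator hA]
  refine lintegral_congr fun z ↦ ?_
  by_cases hz : z ∈ A <;> simp [hz]

/-- For each fixed `a`, testing on all events gives the bound for almost every `z`. The exceptional
set depends on `a`, so only a countable dense set of `a` is used, and the rest follow by density. -/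
lemma le_worstCaseDistortion (hX : AEMeasurable X P) (hZ : AEMeasurable Z P) {c : ℝ≥0∞}
    (h : ∀ a, ∀ A : Set 𝒵, MeasurableSet A →
      ∫⁻ ω, c * A.indicator 1 (Z ω) ∂P ≤ ∫⁻ ω, ‖X ω - a‖ₑ ^ 2 * A.indicator 1 (Z ω) ∂P) :
    c ≤ worstCaseDistortion P X Z := by
  have : IsProbabilityMeasure (P.map Z) := Measure.isProbabilityMeasure_map hZ
  have hae : ∀ a, ∀ᵐ z ∂(P.map Z), c ≤ ∫⁻ x, ‖x - a‖ₑ ^ 2 ∂(condDistrib X Z P z) := by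
    intro a
    refine ae_le_of_forall_setLIntegral_le_of_sigmaFinite measurable_const fun A hA _ ↦ ?_
    rw [setLIntegral_lintegral_condDistrib hX hZ a hA]
    refine le_trans (le_of_eq ?_) (h a A hA)
    rw [← lintegral_indicator hA, lintegral_map' ((measurable_const.indicator hA).aemeasurable) hZ]
    refine lintegral_congr fun ω ↦ ?_
    by_cases hz : Z ω ∈ A <;> simp [hz]
  obtain ⟨D, hDc, hD⟩ := TopologicalSpace.exists_countable_dense (EuclideanSpace ℝ (Fin n))
  refine le_essInf_of_ae_le c ?_
  filter_upwards [(ae_ball_iff hDc).2 fun a _ ↦ hae a] with z hz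
  exact le_iInf fun a ↦ le_lintegral_enorm_sub_sq_of_dense hD hz a

lemma worstCaseDistortion_le (hX : AEMeasurable X P) (hZ : AEMeasurable Z P)
    (a : EuclideanSpace ℝ (Fin n)) :
    worstCaseDistortion P X Z ≤ ∫⁻ ω, ‖X ω - a‖ₑ ^ 2 ∂P := by
  have : IsProbabilityMeasure (P.map Z) := Measure.isProbabilityMeasure_map hZ
  calc worstCaseDistortion P X Z
      = ∫⁻ _, worstCaseDistortion P X Z ∂(P.map Z) := by simp
    _ ≤ ∫⁻ z, ∫⁻ x, ‖x - a‖ₑ ^ 2 ∂(condDistrib X Z P z) ∂(P.map Z) := by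
        refine lintegral_mono_ae ?_
        filter_upwards [ae_essInf_le (f := distortion P X Z) (μ := P.map Z)] with z hz
        exact hz.trans (iInf_le _ a)
    _ = ∫⁻ ω, ‖X ω - a‖ₑ ^ 2 ∂P := by
        simpa using setLIntegral_lintegral_condDistrib hX hZ a MeasurableSet.univ

end

/-! ### Gaussian second moments and lossless decoding -/

lemma lintegral_sub_sq_gaussianReal (m b : ℝ) (v : NNReal) :
    ∫⁻ y, ENNReal.ofReal ((y - b) ^ 2) ∂(gaussianReal m v) =
      ENNReal.ofReal (v + (m - b) ^ 2) := by
  have hmap := gaussianReal_map_sub_const (μ := m) (v := v) b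
  have hlp := memLp_id_gaussianReal (μ := m - b) (v := v) 2
  have hvar := variance_eq_sub hlp
  simp only [variance_id_gaussianReal, Pi.pow_apply, id, integral_id_gaussianReal] at hvar
  rw [← lintegral_map (f := fun y ↦ ENNReal.ofReal (y ^ 2)) (g := fun y ↦ y - b)
    (by fun_prop) (by fun_prop), hmap,
    ← ofReal_integral_eq_lintegral_ofReal (f := fun y ↦ y ^ 2) hlp.integrable_sq
      (ae_of_all _ fun _ ↦ sq_nonneg _)]
  congr 1
  linarith

lemma lintegral_enorm_sub_sq {Ω : Type*} [MeasurableSpace Ω] {P : Measure Ω} {n : ℕ}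
    {X : Ω → EuclideanSpace ℝ (Fin n)} {μ : EuclideanSpace ℝ (Fin n)}
    {S : Matrix (Fin n) (Fin n) ℝ} (hS : S.PosSemidef) (hX : HasLaw X (multivariateGaussian μ S) P)
    (a : EuclideanSpace ℝ (Fin n)) :
    ∫⁻ ω, ‖X ω - a‖ₑ ^ 2 ∂P = ENNReal.ofReal (S.trace + ∑ i, (μ i - a i) ^ 2) := by
  have hlaw : ∀ i, ∫⁻ ω, ENNReal.ofReal ((X ω i - a i) ^ 2) ∂P =
      ENNReal.ofReal (S i i + (μ i - a i) ^ 2) := by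
    intro i
    have h1 := hX.lintegral_comp (f := fun x ↦ ENNReal.ofReal ((x i - a i) ^ 2)) (by fun_prop)
    have h2 := measurePreserving_eval_multivariateGaussian (μ := μ) hS (i := i)
    have h3 := h2.lintegral_comp (f := fun y ↦ ENNReal.ofReal ((y - a i) ^ 2)) (by fun_prop)
    beta_reduce at h1 h3
    rw [h1, h3, lintegral_sub_sq_gaussianReal, Real.coe_toNNReal _ hS.diag_nonneg]
  simp_rw [enorm_sub_sq_eq_sum]
  rw [lintegral_finsetSum' _ fun i _ ↦ ?_]
  · simp_rw [hlaw]
    rw [← ENNReal.ofReal_sum_of_nonneg fun i _ ↦ add_nonneg hS.diag_nonneg (sq_nonneg _),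
      Finset.sum_add_distrib]
    rfl
  · have := hX.aemeasurable
    have h : Measurable fun x : EuclideanSpace ℝ (Fin n) ↦ ENNReal.ofReal ((x i - a i) ^ 2) := by
      fun_prop
    exact h.comp_aemeasurable this

lemma vectorDec_vectorEnc {n k : ℕ} {θ : ℝ} (hθ : 0 < θ) {μ x : EuclideanSpace ℝ (Fin n)}
    {S : Matrix (Fin n) (Fin n) ℝ} (κ : Fin n → Fin k → Bool)
    (hx : ∀ i, √(S i i) = 0 → x i = μ i) :
    vectorDec θ μ S (vectorEnc θ μ S x κ) κ = x := by
  ext i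
  simp only [vectorDec, vectorEnc, scalarDec_scalarEnc hθ]
  by_cases h : √(S i i) = 0
  · simp [h, hx i h]
  · rw [mul_div_cancel₀ _ h]; ring

/-- A coordinate of zero variance is normalised to `0`, so its packet does not carry its value;
decoding returns the mean, which is right almost surely. -/
lemma ae_eq_mean_of_sqrt_eq_zero {Ω : Type*} [MeasurableSpace Ω] {P : Measure Ω} {n : ℕ}
    {μ : EuclideanSpace ℝ (Fin n)} {S : Matrix (Fin n) (Fin n) ℝ} (hS : S.PosSemidef)
    {X : Ω → EuclideanSpace ℝ (Fin n)} (hX : HasLaw X (multivariateGaussian μ S) P) :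
    ∀ᵐ ω ∂P, ∀ i, √(S i i) = 0 → X ω i = μ i := by
  refine ae_all_iff.2 fun i ↦ ?_
  by_cases h : √(S i i) = 0
  · have hz : S i i = 0 := (Real.sqrt_eq_zero hS.diag_nonneg).1 h
    have h2 := measurePreserving_eval_multivariateGaussian (μ := μ) hS (i := i)
    rw [hz, Real.toNNReal_zero, gaussianReal_zero_var] at h2
    have h3 : ∀ᵐ y ∂(Measure.dirac (μ i)), y = μ i := by simp
    rw [← h2.map_eq] at h3
    have h4 := ae_of_ae_map h2.measurable.aemeasurable h3
    rw [← hX.map_eq] at h4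
    filter_upwards [ae_of_ae_map hX.aemeasurable h4] with ω hω _ using hω
  · exact ae_of_all _ fun ω hω ↦ absurd hω h

end DistortionSecurity

open DistortionSecurity

theorem mainTheorem5 {Ω : Type*} [MeasurableSpace Ω] (P : Measure Ω)
    [IsProbabilityMeasure P] (n : ℕ)
    (μ : EuclideanSpace ℝ (Fin n)) (S : Matrix (Fin n) (Fin n) ℝ)
    (hS : S.PosSemidef) (hdiag : S.IsDiag)
    (X : Ω → EuclideanSpace ℝ (Fin n)) (hX : HasLaw X (multivariateGaussian μ S) P)
    -- the shared key: `3 n` independent fair bits, independent of `X`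
    (K : Ω → Fin n → Fin 3 → Bool) (hK : HasLaw K (uniformOn Set.univ) P)
    (hXK : IndepFun X K P) :
    -- the legitimate receiver recovers `X` from the packet and the key
    (∀ᵐ ω ∂P, DistortionSecurity.vectorDec 4.84 μ S
      (DistortionSecurity.vectorEnc 4.84 μ S (X ω) (K ω)) (K ω) = X ω) ∧
    -- the worst case distortion of the eavesdropper
    ENNReal.ofReal (0.9998 * S.trace) ≤
      DistortionSecurity.worstCaseDistortion P X
        (fun ω => DistortionSecurity.vectorEnc 4.84 μ S (X ω) (K ω)) ∧
    -- no observation, whatever the scheme, leads to a larger worst case distortion than `tr S`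
    (∀ (𝒵 : Type*) [MeasurableSpace 𝒵] (Z : Ω → 𝒵), AEMeasurable Z P →
      DistortionSecurity.worstCaseDistortion P X Z ≤ ENNReal.ofReal S.trace) ∧
    -- without any observation the distortion is `tr S`
    DistortionSecurity.worstCaseDistortion P X (fun _ => ()) = ENNReal.ofReal S.trace := by
  have hupper : ∫⁻ ω, ‖X ω - μ‖ₑ ^ 2 ∂P = ENNReal.ofReal S.trace := by
    simp [lintegral_enorm_sub_sq hS hX]
  refine ⟨?_, ?_, fun 𝒵 _ Z hZ ↦ (worstCaseDistortion_le hX.aemeasurable hZ μ).trans_eq hupper,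
    le_antisymm ((worstCaseDistortion_le hX.aemeasurable aemeasurable_const μ).trans_eq hupper) ?_⟩
  · filter_upwards [ae_eq_mean_of_sqrt_eq_zero hS hX] with ω hω
    exact vectorDec_vectorEnc (by norm_num) _ hω
  · have hZ : AEMeasurable (fun ω ↦ vectorEnc 4.84 μ S (X ω) (K ω)) P :=
      measurable_vectorEnc_uncurry.comp_aemeasurable (hX.aemeasurable.prodMk hK.aemeasurable)
    refine le_worstCaseDistortion hX.aemeasurable hZ fun a A hA ↦ ?_
    have hw : Measurable (A.indicator (1 : EuclideanSpace ℝ (Fin n) → ℝ≥0∞)) :=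
      measurable_one.indicator hA
    have hwZ := hw.comp_aemeasurable hZ
    simp only [Function.comp_def] at hwZ
    have hq : ∀ i, AEMeasurable (fun ω ↦ ENNReal.ofReal ((X ω i - a i) ^ 2)) P := fun i ↦
      Measurable.comp_aemeasurable (g := fun x : EuclideanSpace ℝ (Fin n) ↦
        ENNReal.ofReal ((x i - a i) ^ 2)) (by fun_prop) hX.aemeasurable
    have htr : ENNReal.ofReal (0.9998 * S.trace) = ∑ i, ENNReal.ofReal (0.9998 * S i i) := by
      rw [← ENNReal.ofReal_sum_of_nonneg fun i _ ↦ mul_nonneg (by norm_num) hS.diag_nonneg,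
        ← Finset.mul_sum]
      rfl
    rw [htr]
    simp_rw [enorm_sub_sq_eq_sum, Finset.sum_mul]
    rw [lintegral_finsetSum' _ fun i _ ↦ hwZ.const_mul _,
      lintegral_finsetSum' _ fun i _ ↦ (hq i).fun_mul hwZ]
    exact Finset.sum_le_sum fun i _ ↦
      lintegral_coordinate_second_moment hS hdiag hX hK hXK hw i (a i)
  · refine le_worstCaseDistortion hX.aemeasurable aemeasurable_const fun a A hA ↦ ?_
    -- An event of the one-point packet space is everything or empty; in the first case the mean
    -- squared error about `a` is `tr S + ‖μ - a‖²`.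
    by_cases h : () ∈ A
    · simp only [Set.indicator_of_mem h, Pi.one_apply, mul_one, lintegral_const, measure_univ]
      rw [lintegral_enorm_sub_sq hS hX]
      exact ENNReal.ofReal_le_ofReal (le_add_of_nonneg_right
        (Finset.sum_nonneg fun i _ ↦ sq_nonneg _))
    · simp [h]
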